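/- A permutation of length $n\ge 0$ is a sequence $\pi=\pi_1\cdots\pi_n$ of $n$ distinct positive integers, and $|\pi|=n$. Two permutations are disjoint if they have no letter in common; for disjoint $\pi,\sigma$ let $S(\pi,\sigma)$ be the set of permutations of length $|\pi|+|\sigma|$ having both $\pi$ and $\sigma$ as subsequences. A permutation statistic is a function $\mathrm{st}$ on permutations that depends only on the relative order of the letters. It is shuffle-compatible if for disjoint $\pi,\sigma$ the multiset $\{\mathrm{st}(\tau):\tau\in S(\pi,\sigma)\}$ depends only on $\mathrm{st}(\pi),\mathrm{st}(\sigma),|\pi|,|\sigma|$. Write $[\pi]_{\mathrm{st}}$ for the set of permutations of the same length and with the same value of $\mathrm{st}$ as $\pi$. The shuffle algebra $\mathcal A_{\mathrm{st}}$ of a shuffle-compatible $\mathrm{st}$ is the $\mathbb Q$-vector space with basis the classes $[\pi]_{\mathrm{st}}$ and multiplication $[\pi]_{\mathrm{st}}[\sigma]_{\mathrm{st}}=\sum_{\tau\in S(\pi,\sigma)}[\tau]_{\mathrm{st}}$ for disjoint $\pi,\sigma$; its $n$th homogeneous component is spanned by the $[\pi]_{\mathrm{st}}$ with $|\pi|=n$.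 A birun of $\pi$ is a maximal nonempty monotone consecutive subsequence of $\pi$; an up-down run of $\pi$ is either a birun or the one-letter word $\pi_1$ when $\pi_1>\pi_2$; $\mathrm{udr}(\pi)$ is the number of up-down runs of $\pi$. Finally, $\mathbb Q[[t*]][x]$ is the algebra of polynomials in $x$ whose coefficients are formal power series in $t$ over $\mathbb{Q}$, with the Hadamard product $(\sum a_nt^n)*(\sum b_nt^n)=\sum a_nb_nt^n$ as multiplication of coefficients and ordinary multiplication in $x$. In the formulas below, the powers, products and quotients of series in $t$ are the ordinary ones. **Theorem 5.12.** (a) The number of up-down runs $\mathrm{udr}$ is a shuffle-compatible permutation statistic. (b) The linear map on $\mathcal A_{\mathrm{udr}}$ defined by $$[\pi]_{\mathrm{udr}}\mapsto\begin{cases}\dfrac{2^{\mathrm{udr}(\pi)-1}t^{\mathrm{udr}(\pi)}(1+t^2)^{|\pi|-\mathrm{udr}(\pi)}}{(1-t)^2(1-t^2)^{|\pi|-1}}x^{|\pi|}, & |\pi|\ge 1,\\[2ex] \dfrac1{1-t}, & |\pi|=0,\end{cases}$$ is a $\mathbb Q$-algebra isomorphism from $\mathcal A_{\mathrm{udr}}$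 to the span over $\mathbb{Q}$ of $$\left\{\frac1{1-t}\right\}\cup\left\{\frac{2^{j-1}t^j(1+t^2)^{n-j}}{(1-t)^2(1-t^2)^{n-1}}x^n\right\}_{n\ge1,\ 1\le j\le n},$$ which is a subalgebra of $\mathbb Q[[t*]][x]$. (c) For $n\ge1$, the $n$th homogeneous component of $\mathcal A_{\mathrm{udr}}$ has dimension $n$. -/

import Mathlib

namespace ShuffleCompat

/-! ### Permutations, shuffles and statistics -/

/-- A permutation is a finite sequence of distinct positive integers
(not necessarily the integers from `1` to `n`). -/
abbrev Permutation : Type := {π : List ℕ+ // π.Nodup}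

/-- The length `|π|`. -/
def Permutation.length (π : Permutation) : ℕ := π.1.length

/-- Two permutations are disjoint if they have no letters in common. -/
def Permutation.Disjoint (π σ : Permutation) : Prop := List.Disjoint π.1 σ.1

/-- The set `S(π, σ)` of shuffles of two disjoint permutations `π` and `σ`; see `mem_shuffles`. -/
def shuffles (π σ : Permutation) : Finset Permutation :=
  Finset.subtype (fun τ : List ℕ+ => τ.Nodup)
    ((π.1 ++ σ.1).permutations.toFinset.filter
      fun τ => List.Sublist π.1 τ ∧ List.Sublist σ.1 τ)

/-- A shuffle of the disjoint permutations `π` and `σ` is a permutation of length `|π| + |σ|`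
which has both `π` and `σ` as subsequences. -/
theorem mem_shuffles {π σ τ : Permutation} (h : π.Disjoint σ) :
    τ ∈ shuffles π σ ↔
      τ.length = π.length + σ.length ∧ List.Sublist π.1 τ.1 ∧ List.Sublist σ.1 τ.1 := by
  simp only [shuffles, Finset.mem_subtype, Finset.mem_filter, List.mem_toFinset,
    List.mem_permutations, Permutation.length]
  constructor
  · rintro ⟨hp, h1, h2⟩
    exact ⟨by rw [hp.length_eq, List.length_append], h1, h2⟩
  · rintro ⟨hl, h1, h2⟩
    refine ⟨?_, h1, h2⟩
    have hnd : (π.1 ++ σ.1).Nodup := List.nodup_append'.2 ⟨π.2, σ.2, h⟩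
    have hsub : (π.1 ++ σ.1).Subperm τ.1 := by
      refine List.subperm_of_subset hnd ?_
      intro x hx
      rcases List.mem_append.1 hx with hx | hx
      · exact h1.subset hx
      · exact h2.subset hx
    exact (hsub.perm_of_length_le (by rw [hl, List.length_append])).symm

/-- Two permutations have the same relative order: they have the same length and their letters
compare in the same way, position by position. -/
def SameRelativeOrder (π σ : Permutation) : Prop :=
  ∃ h : π.1.length = σ.1.length, ∀ i j : Fin π.1.length,
    π.1.get i < π.1.get j ↔ σ.1.get (i.cast h) < σ.1.get (j.cast h)

/-- A function on permutations is a permutation statistic if it takes the same value on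
permutations with the same relative order. -/
def IsStatistic {α : Type*} (st : Permutation → α) : Prop :=
  ∀ π σ : Permutation, SameRelativeOrder π σ → st π = st σ

/-- The permutation statistic `st` is shuffle-compatible: for disjoint `π` and `σ`, the multiset
`{st(τ) | τ ∈ S(π, σ)}` depends only on `st(π)`, `st(σ)`, `|π|` and `|σ|`. -/
structure ShuffleCompatible {α : Type*} (st : Permutation → α) : Prop where
  isStatistic : IsStatistic st
  map_shuffles_eq : ∀ π π' σ σ' : Permutation, π.Disjoint σ → π'.Disjoint σ' →
    st π = st π' → st σ = st σ' → π.length = π'.length → σ.length = σ'.length →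
    (shuffles π σ).val.map st = (shuffles π' σ').val.map st

/-! ### The shuffle algebra of a statistic -/

/-- `st`-equivalence: equal values of `st` and equal lengths. -/
def stSetoid {α : Type*} (st : Permutation → α) : Setoid Permutation where
  r π σ := st π = st σ ∧ π.length = σ.length
  iseqv := ⟨fun _ => ⟨rfl, rfl⟩, fun h => ⟨h.1.symm, h.2.symm⟩,
    fun h h' => ⟨h.1.trans h'.1, h.2.trans h'.2⟩⟩

/-- The set of `st`-equivalence classes of permutations. -/
abbrev StClass {α : Type*} (st : Permutation → α) : Type := Quotient (stSetoid st)

/-- The vector space over `ℚ` with basis the `st`-equivalence classes. -/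
def ShuffleAlgebra {α : Type*} (st : Permutation → α) : Type := StClass st →₀ ℚ

noncomputable instance {α : Type*} (st : Permutation → α) : AddCommGroup (ShuffleAlgebra st) :=
  inferInstanceAs (AddCommGroup (StClass st →₀ ℚ))

noncomputable instance {α : Type*} (st : Permutation → α) : Module ℚ (ShuffleAlgebra st) :=
  inferInstanceAs (Module ℚ (StClass st →₀ ℚ))

/-- The basis vector `[π]` given by the `st`-equivalence class of `π`. -/
noncomputable def cls {α : Type*} (st : Permutation → α) (π : Permutation) : ShuffleAlgebra st :=
  (Finsupp.single (Quotient.mk (stSetoid st) π) 1 : StClass st →₀ ℚ)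

open Classical in
/-- The product of two equivalence classes: the sum of `[τ]` over the shuffles `τ` of disjoint
representatives `π` and `σ`. Disjoint representatives exist for every permutation statistic, and
when `st` is shuffle-compatible the choice does not matter, see `cls_mul_cls`. -/
noncomputable def mulClass {α : Type*} (st : Permutation → α) (a b : StClass st) :
    ShuffleAlgebra st :=
  if h : ∃ p : Permutation × Permutation, Quotient.mk (stSetoid st) p.1 = a ∧
      Quotient.mk (stSetoid st) p.2 = b ∧ p.1.Disjoint p.2 then
    ∑ τ ∈ shuffles h.choose.1 h.choose.2, cls st τ
  else 0

/-- The bilinear extension of `mulClass`. -/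
noncomputable def mulMap {α : Type*} (st : Permutation → α) :
    ShuffleAlgebra st →ₗ[ℚ] ShuffleAlgebra st →ₗ[ℚ] ShuffleAlgebra st :=
  Finsupp.linearCombination ℚ (M := ShuffleAlgebra st →ₗ[ℚ] ShuffleAlgebra st)
    fun a : StClass st =>
      Finsupp.linearCombination ℚ (M := ShuffleAlgebra st) fun b : StClass st => mulClass st a b

noncomputable instance {α : Type*} (st : Permutation → α) :
    NonUnitalNonAssocRing (ShuffleAlgebra st) where
  mul a b := mulMap st a b
  left_distrib a b c := map_add (mulMap st a) b c
  right_distrib a b c := LinearMap.map_add₂ (mulMap st) a b c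
  zero_mul a := LinearMap.map_zero₂ (mulMap st) a
  mul_zero a := map_zero (mulMap st a)

/-- The multiplication rule `[π][σ] = ∑_{τ ∈ S(π, σ)} [τ]` for all disjoint `π` and `σ`. -/
theorem cls_mul_cls {α : Type*} {st : Permutation → α} (hst : ShuffleCompatible st)
    {π σ : Permutation} (hd : π.Disjoint σ) :
    cls st π * cls st σ = ∑ τ ∈ shuffles π σ, cls st τ := by
  have key : cls st π * cls st σ =
      mulClass st (Quotient.mk (stSetoid st) π) (Quotient.mk (stSetoid st) σ) := by
    change mulMap st (cls st π) (cls st σ) = _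
    unfold mulMap cls
    erw [Finsupp.linearCombination_single, one_smul, Finsupp.linearCombination_single, one_smul]
  have hex : ∃ p : Permutation × Permutation,
      Quotient.mk (stSetoid st) p.1 = Quotient.mk (stSetoid st) π ∧
      Quotient.mk (stSetoid st) p.2 = Quotient.mk (stSetoid st) σ ∧ p.1.Disjoint p.2 :=
    ⟨(π, σ), rfl, rfl, hd⟩
  rw [key, mulClass, dif_pos hex]
  obtain ⟨e1, e2, hd'⟩ := hex.choose_spec
  set p := hex.choose
  have e1' : st p.1 = st π ∧ p.1.length = π.length := Quotient.exact e1
  have e2' : st p.2 = st σ ∧ p.2.length = σ.length := Quotient.exact e2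
  have hm := hst.map_shuffles_eq p.1 π p.2 σ hd' hd e1'.1 e2'.1 e1'.2 e2'.2
  -- on permutations of a fixed length, the class of `τ` is a function of `st τ`
  have aux : ∀ ρ υ : Permutation, ρ.Disjoint υ → ρ.length + υ.length = π.length + σ.length →
      ∑ τ ∈ shuffles ρ υ, cls st τ =
        (((shuffles ρ υ).val.map st).map fun v => open Classical in
          if h : ∃ τ : Permutation, st τ = v ∧ τ.length = π.length + σ.length then
            cls st h.choose else 0).sum := by
    intro ρ υ hρ hl
    rw [Multiset.map_map]
    refine Finset.sum_congr rfl fun τ hτ => ?_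
    have hτl : τ.length = π.length + σ.length := ((mem_shuffles hρ).1 hτ).1.trans hl
    have h : ∃ τ' : Permutation, st τ' = st τ ∧ τ'.length = π.length + σ.length := ⟨τ, rfl, hτl⟩
    simp only [Function.comp]
    rw [dif_pos h]
    have hq : Quotient.mk (stSetoid st) τ = Quotient.mk (stSetoid st) h.choose :=
      Quotient.sound ⟨h.choose_spec.1.symm, hτl.trans h.choose_spec.2.symm⟩
    rw [cls, cls, hq]
  rw [aux p.1 p.2 hd' (by rw [e1'.2, e2'.2]), aux π σ hd rfl, hm]

/-- The `n`th homogeneous component: the span of the classes of permutations of length `n`. -/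
noncomputable def homogeneousComponent {α : Type*} (st : Permutation → α) (n : ℕ) :
    Submodule ℚ (ShuffleAlgebra st) :=
  Submodule.span ℚ {v | ∃ π : Permutation, π.length = n ∧ v = cls st π}

/-! ### Up-down runs -/

/-- `w` is a nonempty consecutive subsequence of `π` that is increasing or decreasing. -/
def IsMonotoneFactor (π : Permutation) (w : List ℕ+) : Prop :=
  w ≠ [] ∧ List.IsInfix w π.1 ∧ (w.Pairwise (· < ·) ∨ w.Pairwise (· > ·))

/-- A birun of `π` is a maximal monotone consecutive subsequence. As the letters of `π` are
distinct, the places of `w` in `π` are determined by `w`. -/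
def IsBirun (π : Permutation) (w : List ℕ+) : Prop :=
  IsMonotoneFactor π w ∧ ∀ v, IsMonotoneFactor π v → List.IsInfix w v → v = w

/-- An up-down run of `π` is either a birun of `π`, or the one-letter word `π₁` when `π₁ > π₂`. -/
def IsUpDownRun (π : Permutation) (w : List ℕ+) : Prop :=
  IsBirun π w ∨ ∃ (a b : ℕ+) (l : List ℕ+), π.1 = a :: b :: l ∧ a > b ∧ w = [a]

/-- The number of up-down runs of `π`. -/
noncomputable def udr (π : Permutation) : ℕ := {w | IsUpDownRun π w}.ncard

/-! ### The target algebra -/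

/-- The algebra `ℚ[[t*]]` of formal power series in `t` under the Hadamard product. A series is
given by its sequence of coefficients, so that the Hadamard product is the pointwise product of
sequences. -/
abbrev HadamardSeries : Type := ℕ → ℚ

/-- A power series, formed with the ordinary product, viewed as an element of `ℚ[[t*]]`. -/
noncomputable def toHadamard : PowerSeries ℚ ≃ₗ[ℚ] HadamardSeries where
  toFun f n := PowerSeries.coeff n f
  map_add' f g := by ext n; simp
  map_smul' c f := by ext n; simp
  invFun := PowerSeries.mk
  left_inv f := by ext n; simp
  right_inv a := by ext n; simp

/-- The power series `2^(j-1) t^j (1+t^2)^(n-j) / ((1-t)^2 (1-t^2)^(n-1))`, for `1 ≤ j ≤ n`. -/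
noncomputable def udrSeries (n j : ℕ) : PowerSeries ℚ :=
  2 ^ (j - 1) * PowerSeries.X ^ j * (1 + PowerSeries.X ^ 2) ^ (n - j) *
    ((1 - PowerSeries.X) ^ 2 * (1 - PowerSeries.X ^ 2) ^ (n - 1))⁻¹

/-- The element `1/(1-t)` of `ℚ[[t*]][x]`. -/
noncomputable def udrGenZero : Polynomial HadamardSeries :=
  Polynomial.C (toHadamard (1 - PowerSeries.X)⁻¹)

/-- The element `2^(j-1) t^j (1+t^2)^(n-j) / ((1-t)^2 (1-t^2)^(n-1)) x^n` of `ℚ[[t*]][x]`. -/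
noncomputable def udrGen (n j : ℕ) : Polynomial HadamardSeries :=
  Polynomial.C (toHadamard (udrSeries n j)) * Polynomial.X ^ n

/-- The span over `ℚ` of `1/(1-t)` and of the `udrGen n j` with `n ≥ 1` and `1 ≤ j ≤ n`. -/
noncomputable def udrSpan : Submodule ℚ (Polynomial HadamardSeries) :=
  Submodule.span ℚ
    ({udrGenZero} ∪ {f | ∃ n j : ℕ, 1 ≤ n ∧ 1 ≤ j ∧ j ≤ n ∧ f = udrGen n j})

end ShuffleCompat

namespace ShuffleCompat

/-! ### Labelings of a word -/

/-! Attach to the letters of a word labels from `0, ..., k - 1` that increase weakly along the word,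
where an even label may be repeated only along an ascent and an odd one only along a descent.
Equivalently, the labelled letters are strictly sorted by `labelKey`, so a labelled word is
determined by its set of labelled letters. Splitting this set according to the letters of disjoint
`π` and `σ` is reversible by sorting. Hence the product of the numbers of labelings of `π` and `σ`
is the sum of these numbers over all shuffles (`card_labelings_mul`): for each `k`, one coefficient
of a Hadamard product.

The generating function in `k` is computed by removing letters from the front. Each step acts on
series of the form `(1 + t) D` with `D` even or odd, and multiplies `D` by `(1 + t^2)/(1 - t^2)` if
the direction stays and by `2t/(1 - t^2)` if it turns (`transfer_same`, `transfer_change`). So the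
count depends only on the length and on the number of turns, with initial direction up because label
`0` is even. That number is `udr - 1` (`udr_eq`), and the result is `udrSeries`
(`card_labelings_cons`).

For fixed length these series have distinct orders `t^j`, so `udrMap` is injective
(`udrMap_injective`). Injectivity turns the product formula `permGen_mul` into
shuffle-compatibility, and then into multiplicativity of `udrMap`. Every value `1 ≤ j ≤ n` of `udr`
occurs (`exists_udr_eq`), which gives the image and the dimensions. -/

/-- The sorting key of a labelled letter: first the label, then the letter, in increasing order
for even labels and in decreasing order for odd labels. -/
def labelKey (p : ℕ × ℕ+) : ℕ ×ₗ ℤ :=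
  toLex (p.1, if Even p.1 then ((p.2 : ℕ) : ℤ) else -((p.2 : ℕ) : ℤ))

theorem labelKey_injective : Function.Injective labelKey := by
  rintro ⟨m, a⟩ ⟨n, b⟩ h
  have h' := Prod.ext_iff.1 (toLex.injective h)
  obtain ⟨h1, h2⟩ := h'
  simp only at h1 h2
  subst h1
  have : (a : ℕ) = b := by
    split_ifs at h2 <;> omega
  rw [PNat.coe_inj.1 this]

/-- The strict order on labelled letters given by `labelKey`. -/
def KeyLT (p q : ℕ × ℕ+) : Prop := labelKey p < labelKey q

instance : DecidableRel KeyLT := fun p q => inferInstanceAs (Decidable (labelKey p < labelKey q))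

instance : IsTrans (ℕ × ℕ+) KeyLT := ⟨fun _ _ _ h h' => lt_trans h h'⟩

theorem keyLT_iff {m n : ℕ} {a b : ℕ+} :
    KeyLT (m, a) (n, b) ↔ m < n ∨ m = n ∧ (if Even m then a < b else b < a) := by
  rw [KeyLT, labelKey, labelKey, Prod.Lex.toLex_lt_toLex]
  refine or_congr Iff.rfl (and_congr_right fun h => ?_)
  simp only at h
  subst h
  simp only
  split_ifs
  · rw [Nat.cast_lt, PNat.coe_lt_coe]
  · rw [neg_lt_neg_iff, Nat.cast_lt, PNat.coe_lt_coe]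

/-- The labelings of the word `l` by labels below `k` for which the labelled word is sorted. -/
def labelings (k : ℕ) : List ℕ+ → Finset (List (ℕ × ℕ+))
  | [] => {[]}
  | a :: l => ((Finset.range k ×ˢ labelings k l).filter
      fun x => ((x.1, a) :: x.2).Pairwise KeyLT).image fun x => (x.1, a) :: x.2

theorem mem_labelings {k : ℕ} {l : List ℕ+} {L : List (ℕ × ℕ+)} :
    L ∈ labelings k l ↔ L.map Prod.snd = l ∧ (∀ p ∈ L, p.1 < k) ∧ L.Pairwise KeyLT := by
  induction l generalizing L with
  | nil =>
    simp only [labelings, Finset.mem_singleton, List.map_eq_nil_iff]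
    constructor
    · rintro rfl; simp
    · exact fun h => h.1
  | cons a l ih =>
    simp only [labelings, Finset.mem_image, Finset.mem_filter, Finset.mem_product,
      Finset.mem_range, Prod.exists, ih]
    constructor
    · rintro ⟨m, L', ⟨⟨hm, h1, h2, -⟩, h4⟩, rfl⟩
      refine ⟨by simp [h1], ?_, h4⟩
      simpa using ⟨hm, fun a b h => h2 (a, b) h⟩
    · rintro ⟨h1, h2, h3⟩
      match L, h1, h2, h3 with
      | (m, b) :: L', e, h2, h3 =>
        simp only [List.map_cons, List.cons.injEq] at e
        obtain ⟨rfl, e⟩ := e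
        refine ⟨m, L', ⟨⟨h2 (m, b) (by simp), e, fun p hp => h2 p (by simp [hp]),
          (List.pairwise_cons.1 h3).2⟩, h3⟩, rfl⟩

/-- Words sorted by `KeyLT` are determined by their letters. -/
theorem eq_of_perm_of_pairwise_keyLT {L M : List (ℕ × ℕ+)} (h : L.Perm M)
    (hL : L.Pairwise KeyLT) (hM : M.Pairwise KeyLT) : L = M :=
  h.eq_of_pairwise (fun _ _ _ _ h1 h2 => absurd h1 (lt_asymm h2)) hL hM

theorem exists_perm_pairwise_keyLT (L : List (ℕ × ℕ+)) (hL : L.Nodup) :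
    ∃ M : List (ℕ × ℕ+), M.Perm L ∧ M.Pairwise KeyLT := by
  let r : ℕ × ℕ+ → ℕ × ℕ+ → Prop := fun p q => labelKey p ≤ labelKey q
  have : Std.Total r := ⟨fun p q => le_total (labelKey p) (labelKey q)⟩
  have : IsTrans _ r := ⟨fun _ _ _ h h' => le_trans h h'⟩
  have : DecidableRel r := fun p q => inferInstanceAs (Decidable (labelKey p ≤ labelKey q))
  refine ⟨L.insertionSort r, List.perm_insertionSort r L, ?_⟩
  have h1 := List.pairwise_insertionSort r L
  have h2 : (L.insertionSort r).Nodup := (List.perm_insertionSort r L).nodup_iff.2 hL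
  exact (h1.and h2).imp fun h => lt_of_le_of_ne h.1 fun e => h.2 (labelKey_injective e)

theorem filter_mem_eq_of_sublist {α : Type*} [DecidableEq α] {l m : List α} (hm : m.Nodup)
    (h : l.Sublist m) : m.filter (· ∈ l) = l := by
  have h1 : l.Sublist (m.filter (· ∈ l)) := by
    have := h.filter (fun x => decide (x ∈ l))
    rwa [List.filter_eq_self.2 (by simp)] at this
  refine (h1.eq_of_length_le ?_).symm
  refine (List.Subperm.length_le (List.subperm_of_subset (hm.filter _) ?_))
  intro x hx
  simpa using (List.mem_filter.1 hx).2

theorem filter_mem_mem_labelings {k : ℕ} {l m : List ℕ+} {L : List (ℕ × ℕ+)} (hm : m.Nodup)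
    (h : l.Sublist m) (hL : L ∈ labelings k m) :
    L.filter (fun p => p.2 ∈ l) ∈ labelings k l := by
  obtain ⟨h1, h2, h3⟩ := mem_labelings.1 hL
  refine mem_labelings.2 ⟨?_, fun p hp => h2 p (List.mem_filter.1 hp).1, h3.filter _⟩
  have e : (L.filter fun p => p.2 ∈ l).map Prod.snd = (L.map Prod.snd).filter (· ∈ l) := by
    rw [List.filter_map]
    rfl
  rw [e, h1, filter_mem_eq_of_sublist hm h]

/-- The numbers of labelings multiply according to the shuffle product. -/
theorem card_labelings_mul (k : ℕ) {π σ : Permutation} (hd : π.Disjoint σ) :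
    (labelings k π.1).card * (labelings k σ.1).card =
      ∑ τ ∈ shuffles π σ, (labelings k τ.1).card := by
  -- A labeled word remembers its underlying word, so the labelings of different shuffles are
  -- disjoint.
  rw [← Finset.card_biUnion, ← Finset.card_product]
  swap
  · intro τ _ τ' _ hne
    refine Finset.disjoint_left.2 fun L hL hL' => hne (Subtype.ext ?_)
    rw [← (mem_labelings.1 hL).1, ← (mem_labelings.1 hL').1]
  symm
  refine Finset.card_bij
    (fun L _ => (L.filter (fun p => p.2 ∈ π.1), L.filter (fun p => p.2 ∈ σ.1))) ?_ ?_ ?_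
  · intro L hL
    obtain ⟨τ, hτ, hL⟩ := Finset.mem_biUnion.1 hL
    obtain ⟨-, h1, h2⟩ := (mem_shuffles hd).1 hτ
    exact Finset.mem_product.2
      ⟨filter_mem_mem_labelings τ.2 h1 hL, filter_mem_mem_labelings τ.2 h2 hL⟩
  -- Injectivity: `L` is a rearrangement of its two parts, and a sorted word is determined up to
  -- equality by its rearrangement class.
  · have key : ∀ L ∈ (shuffles π σ).biUnion fun τ => labelings k τ.1,
        L.Pairwise KeyLT ∧ L.Perm
          (L.filter (fun p => p.2 ∈ π.1) ++ L.filter (fun p => p.2 ∈ σ.1)) := by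
      intro L hL
      obtain ⟨τ, hτ, hL⟩ := Finset.mem_biUnion.1 hL
      obtain ⟨hl, h1, h2⟩ := (mem_shuffles hd).1 hτ
      obtain ⟨e1, -, e3⟩ := mem_labelings.1 hL
      refine ⟨e3, ((List.filter_append_perm (fun p => decide (p.2 ∈ π.1)) L).symm).trans ?_⟩
      refine List.Perm.append_left _ (List.Perm.of_eq (List.filter_congr fun p hp => ?_))
      have hnd : (π.1 ++ σ.1).Nodup := List.nodup_append'.2 ⟨π.2, σ.2, hd⟩
      have hsub : (π.1 ++ σ.1).Subperm τ.1 :=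
        List.subperm_of_subset hnd (List.append_subset.2 ⟨h1.subset, h2.subset⟩)
      have hperm := hsub.perm_of_length_le (by
        rw [List.length_append]; exact le_of_eq hl)
      have hp' : p.2 ∈ π.1 ++ σ.1 := hperm.symm.subset (e1 ▸ List.mem_map_of_mem hp)
      rcases List.mem_append.1 hp' with h | h
      · have h' : p.2 ∉ σ.1 := hd h
        simp [h, h']
      · have h' : p.2 ∉ π.1 := fun h' => hd h' h
        simp [h, h']
    intro L hL M hM h
    simp only [Prod.mk.injEq] at h
    obtain ⟨hL1, hL2⟩ := key L hL
    obtain ⟨hM1, hM2⟩ := key M hM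
    rw [h.1, h.2] at hL2
    exact eq_of_perm_of_pairwise_keyLT (hL2.trans hM2.symm) hL1 hM1
  · rintro ⟨L, M⟩ h
    obtain ⟨hL, hM⟩ := Finset.mem_product.1 h
    obtain ⟨l1, l2, l3⟩ := mem_labelings.1 hL
    obtain ⟨m1, m2, m3⟩ := mem_labelings.1 hM
    simp only at l1 l2 l3 m1 m2 m3
    have hnd : ((L ++ M).map Prod.snd).Nodup := by
      rw [List.map_append, l1, m1]
      exact List.nodup_append'.2 ⟨π.2, σ.2, hd⟩
    -- The preimage is the sorted merge of `L` and `M`; its parts are sorted, hence equal to `L` and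
    -- `M`.
    obtain ⟨N, hN, hN'⟩ := exists_perm_pairwise_keyLT (L ++ M) (List.Nodup.of_map _ hnd)
    have hL' : ∀ p ∈ L, p.2 ∈ π.1 := fun p hp => l1 ▸ List.mem_map_of_mem hp
    have hM' : ∀ p ∈ M, p.2 ∈ σ.1 := fun p hp => m1 ▸ List.mem_map_of_mem hp
    have f1 : N.filter (fun p => p.2 ∈ π.1) = L := by
      refine eq_of_perm_of_pairwise_keyLT ?_ (hN'.filter _) l3
      refine (hN.filter _).trans (List.Perm.of_eq ?_)
      rw [List.filter_append, List.filter_eq_self.2 (by simpa using fun a b => hL' (a, b)),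
        List.filter_eq_nil_iff.2 (fun p hp => by simpa using fun h' => hd h' (hM' p hp)),
        List.append_nil]
    have f2 : N.filter (fun p => p.2 ∈ σ.1) = M := by
      refine eq_of_perm_of_pairwise_keyLT ?_ (hN'.filter _) m3
      refine (hN.filter _).trans (List.Perm.of_eq ?_)
      rw [List.filter_append,
        (List.filter_eq_nil_iff (l := L)).2 (fun p hp => by simpa using hd (hL' p hp)),
        List.filter_eq_self.2 (by simpa using fun a b => hM' (a, b)), List.nil_append]
    have hτ : (N.map Prod.snd).Nodup := (hN.map Prod.snd).nodup_iff.2 hnd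
    refine ⟨N, Finset.mem_biUnion.2 ⟨⟨N.map Prod.snd, hτ⟩, (mem_shuffles hd).2 ⟨?_, ?_, ?_⟩,
      mem_labelings.2 ⟨rfl, ?_, hN'⟩⟩, by rw [f1, f2]⟩
    · simp only [Permutation.length]
      rw [← l1, ← m1, List.length_map, List.length_map, List.length_map, hN.length_eq,
        List.length_append]
    · rw [← l1, ← f1]
      exact List.filter_sublist.map _
    · rw [← m1, ← f2]
      exact List.filter_sublist.map _
    · intro p hp
      rcases List.mem_append.1 (hN.subset hp) with h | h
      exacts [l2 p h, m2 p h]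


/-! ### Counting labelings by the transfer method -/

/-- The number of direction changes in the word `l`, starting with the direction `up`
(`true` for ascending). -/
def changes (up : Bool) : List ℕ+ → ℕ
  | [] => 0
  | [_] => 0
  | a :: b :: l => (if decide (a < b) = up then 0 else 1) + changes (decide (a < b)) (b :: l)

theorem changes_le (up : Bool) (a : ℕ+) (l : List ℕ+) : changes up (a :: l) ≤ l.length := by
  induction l generalizing up a with
  | nil => simp [changes]
  | cons b l ih =>
    have := ih (decide (a < b)) b
    rw [changes, List.length_cons]
    split_ifs <;> omega

/-- The labelings of `l`, counted with a weight depending on the first label. -/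
noncomputable def weightedCount (W : PowerSeries ℚ) (k : ℕ) (l : List ℕ+) : ℚ :=
  ∑ L ∈ labelings k l, PowerSeries.coeff L.headI.1 W

/-- The series `1/(1-t)`. -/
noncomputable def geomSeries : PowerSeries ℚ := PowerSeries.mk 1

theorem geomSeries_mul : geomSeries * (1 - PowerSeries.X) = 1 :=
  PowerSeries.mk_one_mul_one_sub_eq_one ℚ

/-- The part of a power series with even (`true`) or odd (`false`) exponents. -/
noncomputable def parityPart (up : Bool) (W : PowerSeries ℚ) : PowerSeries ℚ :=
  PowerSeries.mk fun n => if Even n ↔ up then PowerSeries.coeff n W else 0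

/-- Adding or subtracting `W(-t)` cancels the exponents of one parity and doubles the others. This
turns `parityPart` into algebra with `evalNegHom`. -/
theorem two_mul_parityPart (up : Bool) (W : PowerSeries ℚ) :
    2 * parityPart up W = W + (if up then 1 else -1) * PowerSeries.evalNegHom W := by
  ext n
  have h2 : (2 : PowerSeries ℚ) = PowerSeries.C 2 := (map_ofNat PowerSeries.C 2).symm
  have hc : ((if up then 1 else -1 : PowerSeries ℚ)) = PowerSeries.C (if up then 1 else -1) := by
    cases up <;> simp
  rw [h2, hc, map_add, PowerSeries.coeff_C_mul, PowerSeries.coeff_C_mul, parityPart,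
    PowerSeries.coeff_mk, PowerSeries.evalNegHom, PowerSeries.coeff_rescale]
  rcases Nat.even_or_odd n with h | h
  · cases up <;> simp [h]; ring
  · cases up <;> simp [h, Nat.not_even_iff_odd.2 h]; ring

/-- The transfer operator: prepending a smaller labelled letter. -/
noncomputable def transfer (up : Bool) (W : PowerSeries ℚ) : PowerSeries ℚ :=
  PowerSeries.X * geomSeries * W + parityPart up W

theorem coeff_X_mul_geomSeries_mul (W : PowerSeries ℚ) (n : ℕ) :
    PowerSeries.coeff n (PowerSeries.X * geomSeries * W) =
      ∑ i ∈ Finset.range n, PowerSeries.coeff i W := by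
  -- This is the recurrence of partial sums, read off coefficientwise.
  have h : PowerSeries.X * geomSeries * W =
      PowerSeries.X * W + PowerSeries.X * (PowerSeries.X * geomSeries * W) := by
    linear_combination PowerSeries.X * W * geomSeries_mul
  induction n with
  | zero => simp [mul_assoc]
  | succ n ih =>
    have h' := congrArg (PowerSeries.coeff (n + 1)) h
    rw [map_add, PowerSeries.coeff_succ_X_mul, PowerSeries.coeff_succ_X_mul] at h'
    rw [Finset.sum_range_succ, ← ih, h', add_comm]

theorem weightedCount_singleton (W : PowerSeries ℚ) (k : ℕ) (a : ℕ+) :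
    weightedCount W k [a] = PowerSeries.coeff k (PowerSeries.X * geomSeries * W) := by
  rw [coeff_X_mul_geomSeries_mul, weightedCount, labelings, Finset.sum_image]
  · rw [Finset.sum_filter, Finset.sum_product]
    simp [labelings]
  · rintro ⟨m, L⟩ - ⟨n, M⟩ - h
    simpa using h

/-- If `b` has label `m`, then `a` may have any smaller label, or `m` itself when the parity of `m`
fits the direction from `a` to `b`. Summing the weights of these labels gives the new weight at `m`.
-/
theorem weightedCount_cons_cons (W : PowerSeries ℚ) (k : ℕ) {a b : ℕ+} (hab : a ≠ b)
    (l : List ℕ+) :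
    weightedCount W k (a :: b :: l) = weightedCount (transfer (decide (a < b)) W) k (b :: l) := by
  rw [weightedCount, labelings, Finset.sum_image]
  · rw [Finset.sum_filter, Finset.sum_product_right, weightedCount]
    refine Finset.sum_congr rfl fun L hL => ?_
    obtain ⟨h1, h2, h3⟩ := mem_labelings.1 hL
    match L, h1, h2, h3 with
    | (m, c) :: L, e, h2, h3 =>
      simp only [List.map_cons, List.cons.injEq] at e
      obtain ⟨rfl, -⟩ := e
      have hm : m < k := h2 (m, c) (by simp)
      -- By transitivity only the comparison with the next labelled letter matters.
      have hp : ∀ i, (((i, a) :: (m, c) :: L).Pairwise KeyLT) ↔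
          (i < m ∨ i = m ∧ (Even m ↔ a < c)) := by
        intro i
        rw [← List.isChain_iff_pairwise, List.isChain_cons_cons, List.isChain_iff_pairwise,
          and_iff_left h3, keyLT_iff]
        refine or_congr Iff.rfl (and_congr_right fun h => ?_)
        subst h
        rcases lt_or_gt_of_ne hab with h | h
        · simp [h, h.not_gt]
        · simp [h, h.not_gt]
      simp only [hp, List.headI_cons, transfer, map_add, coeff_X_mul_geomSeries_mul]
      rw [← Finset.sum_filter, Finset.filter_or, Finset.sum_union]
      · congr 1
        · refine Finset.sum_congr ?_ fun _ _ => rfl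
          ext i
          simp only [Finset.mem_filter, Finset.mem_range]
          omega
        · rw [Finset.sum_filter, parityPart, PowerSeries.coeff_mk]
          simp only [decide_eq_true_eq, ite_and]
          rw [Finset.sum_ite_eq' (Finset.range k) m
            (fun i => if (Even m ↔ a < c) then PowerSeries.coeff i W else 0)]
          simp [hm]
      · refine Finset.disjoint_left.2 fun i h h' => ?_
        simp only [Finset.mem_filter] at h h'
        omega
  · rintro ⟨m, L⟩ - ⟨n, M⟩ - h
    simpa using h

/-- The series `1/(1-t^2)`. -/
noncomputable def evenGeomSeries : PowerSeries ℚ := (1 - PowerSeries.X ^ 2)⁻¹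

theorem evenGeomSeries_mul : evenGeomSeries * (1 - PowerSeries.X ^ 2) = 1 :=
  PowerSeries.inv_mul_cancel _ (by simp)

theorem geomSeries_eq : geomSeries = (1 + PowerSeries.X) * evenGeomSeries := by
  linear_combination (1 + PowerSeries.X) * evenGeomSeries * geomSeries_mul -
    geomSeries * evenGeomSeries_mul

theorem evalNegHom_evenGeomSeries :
    PowerSeries.evalNegHom evenGeomSeries = evenGeomSeries := by
  have h := congrArg (PowerSeries.evalNegHom (A := ℚ)) evenGeomSeries_mul
  simp only [map_mul, map_sub, map_one, map_pow, PowerSeries.evalNegHom_X, neg_sq] at h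
  linear_combination evenGeomSeries * h - PowerSeries.evalNegHom evenGeomSeries *
    evenGeomSeries_mul

theorem two_powerSeries_ne_zero : (2 : PowerSeries ℚ) ≠ 0 := by
  intro h
  have := congrArg PowerSeries.constantCoeff h
  rw [map_ofNat, map_zero] at this
  norm_num at this

/-- The parity part selected from `(1 + t) D` is `D`, and `t(1 + t) + (1 - t) = 1 + t^2`. The new
factor is even, so the parity of `D` persists. -/
theorem transfer_same {up : Bool} {D : PowerSeries ℚ}
    (hD : PowerSeries.evalNegHom D = (if up then 1 else -1) * D) :
    transfer up ((1 + PowerSeries.X) * D) =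
      (1 + PowerSeries.X) * ((1 + PowerSeries.X ^ 2) * evenGeomSeries * D) := by
  have h := two_mul_parityPart up ((1 + PowerSeries.X) * D)
  rw [map_mul, hD] at h
  simp only [map_add, map_one, PowerSeries.evalNegHom_X] at h
  apply mul_left_cancel₀ two_powerSeries_ne_zero
  rw [transfer, geomSeries_eq, mul_add, h]
  cases up <;> simp <;>
  linear_combination (-2 : PowerSeries ℚ) * D * evenGeomSeries_mul

/-- Now the selected part is `t D`, and `(1 + t) + (1 - t) = 2`. The new factor is odd, so the
parity of `D` flips together with the direction. -/
theorem transfer_change {up : Bool} {D : PowerSeries ℚ}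
    (hD : PowerSeries.evalNegHom D = (if up then 1 else -1) * D) :
    transfer (!up) ((1 + PowerSeries.X) * D) =
      (1 + PowerSeries.X) * (2 * PowerSeries.X * evenGeomSeries * D) := by
  have h := two_mul_parityPart (!up) ((1 + PowerSeries.X) * D)
  rw [map_mul, hD] at h
  simp only [map_add, map_one, PowerSeries.evalNegHom_X] at h
  apply mul_left_cancel₀ two_powerSeries_ne_zero
  rw [transfer, geomSeries_eq, mul_add, h]
  cases up <;> simp <;>
  linear_combination (-2 : PowerSeries ℚ) * PowerSeries.X * D * evenGeomSeries_mul

/-- The hypothesis ties the parity of `D` to the current direction; both transfer rules preserve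
this link, which is what lets the induction run. -/
theorem weightedCount_eq (k : ℕ) (up : Bool) (D : PowerSeries ℚ)
    (hD : PowerSeries.evalNegHom D = (if up then 1 else -1) * D) (a : ℕ+) (l : List ℕ+)
    (hl : (a :: l).Nodup) :
    weightedCount ((1 + PowerSeries.X) * D) k (a :: l) =
      PowerSeries.coeff k (PowerSeries.X * geomSeries * ((1 + PowerSeries.X) * (D *
        (2 * PowerSeries.X) ^ changes up (a :: l) *
        (1 + PowerSeries.X ^ 2) ^ (l.length - changes up (a :: l)) *
        evenGeomSeries ^ l.length))) := by
  induction l generalizing up D a with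
  | nil => simp [weightedCount_singleton, changes]
  | cons b l ih =>
    have hab : a ≠ b := by rintro rfl; simp at hl
    have hc := changes_le (decide (a < b)) b l
    rw [weightedCount_cons_cons _ _ hab, changes]
    split_ifs with h
    · rw [h, transfer_same hD, ih up _ _ b (List.nodup_cons.1 hl).2]
      · rw [h] at hc
        have e : (b :: l).length - (0 + changes up (b :: l)) =
            l.length - changes up (b :: l) + 1 := by
          rw [List.length_cons]; omega
        rw [e, List.length_cons]
        congr 1
        ring
      · simp only [map_mul, hD, evalNegHom_evenGeomSeries, map_add, map_pow, map_one,
          PowerSeries.evalNegHom_X]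
        ring
    · have h' : decide (a < b) = !up := by
        cases up <;> simp_all
      rw [h', transfer_change hD, ih (!up) _ _ b (List.nodup_cons.1 hl).2]
      · rw [h'] at hc
        have e : (b :: l).length - (1 + changes (!up) (b :: l)) =
            l.length - changes (!up) (b :: l) := by
          rw [List.length_cons]; omega
        rw [e, List.length_cons]
        congr 1
        ring
      · simp only [map_mul, hD, evalNegHom_evenGeomSeries, PowerSeries.evalNegHom_X, map_ofNat]
        cases up <;> simp

theorem udrSeries_eq (n c : ℕ) :
    udrSeries (n + 1) (c + 1) = PowerSeries.X * geomSeries * ((1 + PowerSeries.X) *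
      (evenGeomSeries * (2 * PowerSeries.X) ^ c * (1 + PowerSeries.X ^ 2) ^ (n - c) *
        evenGeomSeries ^ n)) := by
  symm
  rw [udrSeries, PowerSeries.eq_mul_inv_iff_mul_eq (by simp)]
  simp only [Nat.add_sub_cancel, Nat.add_sub_add_right]
  have h1 : (1 + PowerSeries.X) * evenGeomSeries = geomSeries := geomSeries_eq.symm
  have h2 : evenGeomSeries ^ n * (1 - PowerSeries.X ^ 2) ^ n = 1 := by
    rw [← mul_pow, evenGeomSeries_mul, one_pow]
  have h3 : geomSeries ^ 2 * (1 - PowerSeries.X) ^ 2 = 1 := by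
    rw [← mul_pow, geomSeries_mul, one_pow]
  calc _ = PowerSeries.X * (2 * PowerSeries.X) ^ c * (1 + PowerSeries.X ^ 2) ^ (n - c) *
        (geomSeries * ((1 + PowerSeries.X) * evenGeomSeries) * (1 - PowerSeries.X) ^ 2) *
        (evenGeomSeries ^ n * (1 - PowerSeries.X ^ 2) ^ n) := by ring
    _ = _ := by
      rw [h1, h2, ← pow_two, h3]
      ring

/-- Plain counting uses the weight `1/(1 - t) = (1 + t)/(1 - t^2)`, where `D = 1/(1 - t^2)` is even;
this is why the initial direction is up. -/
theorem card_labelings_cons (k : ℕ) (a : ℕ+) (l : List ℕ+) (hl : (a :: l).Nodup) :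
    ((labelings k (a :: l)).card : ℚ) =
      PowerSeries.coeff k (udrSeries (l.length + 1) (changes true (a :: l) + 1)) := by
  rw [udrSeries_eq, ← weightedCount_eq k true evenGeomSeries
    (by simp [evalNegHom_evenGeomSeries]) a l hl, ← geomSeries_eq]
  simp [weightedCount, geomSeries]


/-! ### Biruns and direction changes -/

/-- A word is monotone if it is increasing or decreasing. -/
def IsMonotoneWord (w : List ℕ+) : Prop := w.Pairwise (· < ·) ∨ w.Pairwise (· > ·)

theorem IsMonotoneWord.sublist {v w : List ℕ+} (hw : IsMonotoneWord w) (h : v.Sublist w) :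
    IsMonotoneWord v :=
  hw.imp (fun h' => h'.sublist h) (fun h' => h'.sublist h)

theorem isMonotoneWord_pair {a b : ℕ+} (h : a ≠ b) : IsMonotoneWord [a, b] := by
  rcases lt_or_gt_of_ne h with h | h
  · left; simpa using h
  · right; simpa using h

theorem isMonotoneWord_cons_iff {a b c : ℕ+} {l : List ℕ+} (hab : a ≠ b) (hbc : b ≠ c)
    (h : IsMonotoneWord (b :: c :: l)) :
    IsMonotoneWord (a :: b :: c :: l) ↔ (decide (a < b) = decide (b < c)) := by
  simp only [IsMonotoneWord, ← List.isChain_iff_pairwise, List.isChain_cons_cons] at h ⊢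
  rcases lt_or_gt_of_ne hab with h1 | h1 <;> rcases lt_or_gt_of_ne hbc with h2 | h2 <;>
    simp_all [h1.not_gt, h2.not_gt]

/-- `w` is a nonempty monotone factor of `l`. -/
def MonoFactor (l w : List ℕ+) : Prop := w ≠ [] ∧ w <:+: l ∧ IsMonotoneWord w

/-- The maximal monotone factors of `l`. -/
def biruns (l : List ℕ+) : Set (List ℕ+) :=
  {w | MonoFactor l w ∧ ∀ v, MonoFactor l v → w <:+: v → v = w}

/-- `w` is the longest monotone prefix of `l`. -/
def IsFirstRun (l w : List ℕ+) : Prop :=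
  w <+: l ∧ IsMonotoneWord w ∧ ∀ v, v <+: l → IsMonotoneWord v → v <+: w

theorem infix_cons_of_not_mem {a : ℕ+} {w l : List ℕ+} (h : w <:+: a :: l) (ha : a ∉ w) :
    w <:+: l := by
  rcases List.infix_cons_iff.1 h with h | h
  · match w, h, ha with
    | [], _, _ => exact List.nil_infix
    | b :: w, h, ha =>
      rw [List.cons_prefix_cons] at h
      simp [h.1] at ha
  · exact h

theorem exists_prefix_of_infix_of_mem {a : ℕ+} {w l : List ℕ+} (h : w <:+: a :: l)
    (hl : (a :: l).Nodup) (ha : a ∈ w) : ∃ w', w = a :: w' ∧ w' <+: l := by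
  rcases List.infix_cons_iff.1 h with h | h
  · match w, h, ha with
    | b :: w, h, ha =>
      rw [List.cons_prefix_cons] at h
      exact ⟨w, by rw [h.1], h.2⟩
  · exact absurd (h.subset ha) (List.nodup_cons.1 hl).1

/-- Since letters are distinct, a factor containing the first letter is a prefix, so maximality
among prefixes suffices. -/
theorem IsFirstRun.mem_biruns {b : ℕ+} {l w : List ℕ+} (hl : (b :: l).Nodup)
    (h : IsFirstRun (b :: l) w) : w ∈ biruns (b :: l) ∧ b ∈ w := by
  obtain ⟨h1, h2, h3⟩ := h
  have hb : [b] <+: w := h3 [b] (by simp) (by left; simp)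
  have hbw : b ∈ w := hb.subset (by simp)
  refine ⟨⟨⟨List.ne_nil_of_mem hbw, h1.isInfix, h2⟩, ?_⟩, hbw⟩
  rintro v ⟨-, v2, v3⟩ hwv
  obtain ⟨v', rfl, hv'⟩ := exists_prefix_of_infix_of_mem v2 hl (hwv.subset hbw)
  have := h3 (b :: v') (by simpa using hv') v3
  exact this.eq_of_length_le hwv.length_le

theorem MonoFactor.cons {a : ℕ+} {l w : List ℕ+} (h : MonoFactor l w) : MonoFactor (a :: l) w :=
  ⟨h.1, List.infix_cons h.2.1, h.2.2⟩

/-- If `a` extends the first run of `l`, then it extends the first birun of `l`. -/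
theorem biruns_cons_of_extend {a : ℕ+} {l w : List ℕ+} (hl : (a :: l).Nodup)
    (hw : IsFirstRun l w) (ha : IsMonotoneWord (a :: w)) :
    IsFirstRun (a :: l) (a :: w) ∧ biruns (a :: l) = insert (a :: w) (biruns l \ {w}) := by
  obtain ⟨h1, h2, h3⟩ := hw
  have hal : a ∉ l := (List.nodup_cons.1 hl).1
  have hF : IsFirstRun (a :: l) (a :: w) := by
    refine ⟨by simpa using h1, ha, fun v hv hm => ?_⟩
    rcases List.prefix_cons_iff.1 hv with rfl | ⟨v', rfl, hv'⟩
    · exact List.nil_prefix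
    · simpa using h3 v' hv' (hm.sublist (List.sublist_cons_self _ _))
  refine ⟨hF, Set.ext fun u => ?_⟩
  simp only [Set.mem_insert_iff, Set.mem_sdiff, Set.mem_singleton_iff]
  constructor
  · rintro ⟨u1, u2⟩
    by_cases hau : a ∈ u
    · left
      obtain ⟨u', rfl, hu'⟩ := exists_prefix_of_infix_of_mem u1.2.1 hl hau
      have hp : u' <+: w := h3 u' hu' (u1.2.2.sublist (List.sublist_cons_self _ _))
      exact (u2 (a :: w) (hF.mem_biruns hl).1.1 (by
        have : a :: u' <+: a :: w := by simpa using hp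
        exact this.isInfix)).symm
    · right
      refine ⟨⟨⟨u1.1, infix_cons_of_not_mem u1.2.1 hau, u1.2.2⟩,
        fun v hv huv => u2 v hv.cons huv⟩, ?_⟩
      rintro rfl
      have := u2 (a :: u) (hF.mem_biruns hl).1.1 (List.suffix_cons _ _).isInfix
      simp at this
  · rintro (rfl | ⟨⟨u1, u2⟩, hne⟩)
    · exact (hF.mem_biruns hl).1
    · refine ⟨u1.cons, fun v hv huv => ?_⟩
      have hau : a ∉ u := fun h => hal (u1.2.1.subset h)
      by_cases hav : a ∈ v
      -- A larger monotone factor through `a` would place `u` inside the first run `w`, and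
      -- maximality of `u` would give `u = w`.
      · obtain ⟨v', rfl, hv'⟩ := exists_prefix_of_infix_of_mem hv.2.1 hl hav
        have hp : v' <+: w := h3 v' hv' (hv.2.2.sublist (List.sublist_cons_self _ _))
        have huw : u <:+: w := (infix_cons_of_not_mem huv hau).trans hp.isInfix
        have hw0 : w ≠ [] := by
          rintro rfl
          exact u1.1 (List.infix_nil.1 huw)
        exact absurd (u2 w ⟨hw0, h1.isInfix, h2⟩ huw).symm hne
      · exact u2 v ⟨hv.1, infix_cons_of_not_mem hv.2.1 hav, hv.2.2⟩ huv

/-- If `a` does not extend the first run of `b :: l`, then `a`, `b` is a new birun. -/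
theorem biruns_cons_of_turn {a b : ℕ+} {l w : List ℕ+} (hl : (a :: b :: l).Nodup)
    (hw : IsFirstRun (b :: l) w) (ha : ¬IsMonotoneWord (a :: w)) :
    IsFirstRun (a :: b :: l) [a, b] ∧ biruns (a :: b :: l) = insert [a, b] (biruns (b :: l)) := by
  have hal : a ∉ b :: l := (List.nodup_cons.1 hl).1
  have hab : a ≠ b := by rintro rfl; simp at hal
  have hl' : (b :: l).Nodup := (List.nodup_cons.1 hl).2
  have hb := hw.mem_biruns hl'
  obtain ⟨h1, h2, h3⟩ := hw
  -- If `a` continued monotonically through two letters of the first run, its direction would agree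
  -- with that of the whole run, against `ha`.
  have hshort : ∀ v, v <+: b :: l → IsMonotoneWord (a :: v) → v <+: [b] := by
    intro v hv hm
    have hp := h3 v hv (hm.sublist (List.sublist_cons_self _ _))
    match v, hv, hm, hp with
    | [], _, _, _ => exact List.nil_prefix
    | [c], hv, _, _ => simpa using hv
    | c :: d :: v, hv, hm, ⟨s, hs⟩ =>
      rw [← hs] at h2 ha
      have hbl := List.cons_prefix_cons.1 hv
      obtain ⟨rfl, hdv⟩ := hbl
      have hcd : c ≠ d := by
        rintro rfl
        exact (List.nodup_cons.1 hl').1 (hdv.subset (by simp))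
      rw [isMonotoneWord_cons_iff hab hcd (hm.sublist (List.sublist_cons_self _ _))] at hm
      exact absurd ((isMonotoneWord_cons_iff hab hcd h2).2 hm) ha
  have hF : IsFirstRun (a :: b :: l) [a, b] := by
    refine ⟨by simp, isMonotoneWord_pair hab, fun v hv hm => ?_⟩
    rcases List.prefix_cons_iff.1 hv with rfl | ⟨v', rfl, hv'⟩
    · exact List.nil_prefix
    · simpa using hshort v' hv' hm
  refine ⟨hF, Set.ext fun u => ?_⟩
  simp only [Set.mem_insert_iff]
  constructor
  · rintro ⟨u1, u2⟩
    by_cases hau : a ∈ u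
    · left
      obtain ⟨u', rfl, hu'⟩ := exists_prefix_of_infix_of_mem u1.2.1 hl hau
      exact (u2 [a, b] (hF.mem_biruns hl).1.1 (by
        have : a :: u' <+: [a, b] := by simpa using hshort u' hu' u1.2.2
        exact this.isInfix)).symm
    · right
      exact ⟨⟨u1.1, infix_cons_of_not_mem u1.2.1 hau, u1.2.2⟩,
        fun v hv huv => u2 v hv.cons huv⟩
  · rintro (rfl | ⟨u1, u2⟩)
    · exact (hF.mem_biruns hl).1
    · refine ⟨u1.cons, fun v hv huv => ?_⟩
      have hau : a ∉ u := fun h => hal (u1.2.1.subset h)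
      by_cases hav : a ∈ v
      · obtain ⟨v', rfl, hv'⟩ := exists_prefix_of_infix_of_mem hv.2.1 hl hav
        -- Only `[b]` could lose maximality; but if `[b]` is a birun it is the whole first run, and
        -- then `a` would extend it.
        have hub : u <:+: [b] :=
          (infix_cons_of_not_mem huv hau).trans (hshort v' hv' hv.2.2).isInfix
        have hub' : u = [b] := hub.eq_of_length_le (by
          have := List.length_pos_iff.2 u1.1
          simpa [Nat.succ_le_iff] using this)
        subst hub'
        have hbw : [b] <+: w := h3 [b] (by simp) (by left; simp)
        have hwb : w = [b] := u2 w hb.1.1 hbw.isInfix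
        rw [hwb] at ha
        exact absurd (isMonotoneWord_pair hab) ha
      · exact u2 v ⟨hv.1, infix_cons_of_not_mem hv.2.1 hav, hv.2.2⟩ huv

theorem biruns_singleton (a : ℕ+) : IsFirstRun [a] [a] ∧ biruns [a] = {[a]} := by
  have hF : IsFirstRun [a] [a] := ⟨List.prefix_rfl, by left; simp, fun v hv _ => hv⟩
  refine ⟨hF, Set.ext fun u => ⟨?_, ?_⟩⟩
  · rintro ⟨u1, -⟩
    exact u1.2.1.eq_of_length_le (by
      have := List.length_pos_iff.2 u1.1
      simpa [Nat.succ_le_iff] using this)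
  · rintro rfl
    exact (hF.mem_biruns (by simp)).1

/-- A word with at least two letters has one birun more than direction changes, the first
direction being that of the first two letters. -/
theorem biruns_cons_cons (l : List ℕ+) (a b : ℕ+) (hl : (a :: b :: l).Nodup) :
    (∃ w, IsFirstRun (a :: b :: l) (a :: b :: w)) ∧ (biruns (a :: b :: l)).Finite ∧
      (biruns (a :: b :: l)).ncard = changes (decide (a < b)) (a :: b :: l) + 1 := by
  have hal : a ∉ b :: l := (List.nodup_cons.1 hl).1
  have hab : a ≠ b := by rintro rfl; simp at hal
  have hl' : (b :: l).Nodup := (List.nodup_cons.1 hl).2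
  have hnot : ∀ w, a :: w ∉ biruns (b :: l) := fun w hw => hal (hw.1.2.1.subset (by simp))
  induction l generalizing a b with
  | nil =>
    obtain ⟨h1, h2⟩ := biruns_cons_of_extend hl (biruns_singleton b).1 (isMonotoneWord_pair hab)
    refine ⟨⟨[], h1⟩, ?_⟩
    rw [h2, (biruns_singleton b).2]
    simp [changes]
  | cons c l ih =>
    have hbl : b ∉ c :: l := (List.nodup_cons.1 hl').1
    have hbc : b ≠ c := by rintro rfl; simp at hbl
    obtain ⟨⟨w, hw⟩, hfin, hcard⟩ := ih b c hl' hbl hbc (List.nodup_cons.1 hl').2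
      fun w hw => hbl (hw.1.2.1.subset (by simp))
    have hiff := isMonotoneWord_cons_iff hab hbc hw.2.1
    by_cases hm : IsMonotoneWord (a :: b :: c :: w)
    · obtain ⟨h1, h2⟩ := biruns_cons_of_extend hl hw hm
      refine ⟨⟨_, h1⟩, ?_⟩
      rw [h2]
      refine ⟨(hfin.subset Set.sdiff_subset).insert _, ?_⟩
      rw [Set.ncard_insert_of_notMem (fun h => hnot _ h.1) (hfin.subset Set.sdiff_subset),
        Set.ncard_sdiff_singleton_add_one (hw.mem_biruns hl').1 hfin, hcard, hiff.1 hm]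
      simp only [changes, hiff.1 hm, if_pos, zero_add]
    · obtain ⟨h1, h2⟩ := biruns_cons_of_turn hl hw hm
      refine ⟨⟨_, h1⟩, ?_⟩
      rw [h2]
      refine ⟨hfin.insert _, ?_⟩
      have hne : ¬decide (b < c) = decide (a < b) := fun h => hm (hiff.2 h.symm)
      rw [Set.ncard_insert_of_notMem (hnot _) hfin, hcard]
      simp only [changes, if_pos, if_neg hne]
      omega

/-- The number of up-down runs is one more than the number of direction changes, the initial
direction being ascending. -/
theorem udr_eq (π : Permutation) (h : π.1 ≠ []) : udr π = changes true π.1 + 1 := by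
  obtain ⟨l, hl⟩ := π
  have hset : {w | IsUpDownRun ⟨l, hl⟩ w} = biruns l ∪
      {w | ∃ (a b : ℕ+) (l' : List ℕ+), l = a :: b :: l' ∧ a > b ∧ w = [a]} := rfl
  rw [udr, hset]
  match l, hl, h with
  | [a], hl, h =>
    rw [(biruns_singleton a).2]
    simp [changes]
  | a :: b :: l, hl, h =>
    obtain ⟨⟨w, hw⟩, hfin, hcard⟩ := biruns_cons_cons l a b hl
    have hab : a ≠ b := by rintro rfl; simp at hl
    rcases lt_or_gt_of_ne hab with h | h
    · have he : {w | ∃ (a' b' : ℕ+) (l' : List ℕ+), a :: b :: l = a' :: b' :: l' ∧ a' > b' ∧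
          w = [a']} = ∅ := by
        refine Set.eq_empty_of_forall_notMem ?_
        rintro w ⟨a', b', l', e, h', -⟩
        simp only [List.cons.injEq] at e
        obtain ⟨rfl, rfl, -⟩ := e
        exact lt_asymm h h'
      rw [he, Set.union_empty, hcard]
      simp [h]
    · have he : {w | ∃ (a' b' : ℕ+) (l' : List ℕ+), a :: b :: l = a' :: b' :: l' ∧ a' > b' ∧
          w = [a']} = {[a]} := by
        refine Set.ext fun w => ⟨?_, ?_⟩
        · rintro ⟨a', b', l', e, -, rfl⟩
          simp only [List.cons.injEq] at e
          rw [e.1]; rfl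
        · rintro rfl
          exact ⟨a, b, l, rfl, h, rfl⟩
      -- The extra one-letter run is a new element because the first birun has at least two letters.
      -- It accounts for the initial turn from up to down.
      have hna : [a] ∉ biruns (a :: b :: l) := by
        intro h'
        have := h'.2 _ (hw.mem_biruns hl).1.1 ⟨[], b :: w, by simp⟩
        simp at this
      rw [he, Set.union_singleton, Set.ncard_insert_of_notMem hna hfin, hcard]
      simp only [changes, h.not_gt, decide_false]
      simp
      omega

theorem udr_nil (π : Permutation) (h : π.1 = []) : udr π = 0 := by
  have : {w | IsUpDownRun π w} = ∅ := by
    refine Set.eq_empty_of_forall_notMem ?_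
    rintro w (⟨⟨h1, h2, -⟩, -⟩ | ⟨a, b, l, h', -⟩)
    · rw [h] at h2
      exact h1 (List.infix_nil.1 h2)
    · rw [h] at h'
      simp at h'
  rw [udr, this, Set.ncard_empty]


/-! ### Permutations with given numbers of up-down runs -/

theorem changes_congr (up : Bool) (l l' : List ℕ+) (h : l.length = l'.length)
    (hlt : ∀ i (hi : i + 1 < l.length),
      l[i] < l[i + 1] ↔ l'[i] < l'[i + 1]) : changes up l = changes up l' := by
  induction l generalizing l' up with
  | nil =>
    match l', h with
    | [], _ => rfl
  | cons a l ih =>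
    match l', l, h, hlt, ih with
    | [a'], [], _, _, _ => rfl
    | a' :: b' :: l', b :: l, h, hlt, ih =>
      have h0 : a < b ↔ a' < b' := by simpa using hlt 0 (by simp)
      have := fun up => ih up (b' :: l') (by simpa using h) fun i hi =>
        hlt (i + 1) (by simpa using hi)
      simp only [changes, h0, this]

theorem isStatistic_udr : IsStatistic udr := by
  rintro π σ ⟨h, hlt⟩
  by_cases hπ : π.1 = []
  · have hσ : σ.1 = [] := List.length_eq_zero_iff.1 (by rw [← h, hπ]; rfl)
    rw [udr_nil π hπ, udr_nil σ hσ]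
  · have hσ : σ.1 ≠ [] := fun h' => hπ (List.length_eq_zero_iff.1 (by rw [h, h']; rfl))
    rw [udr_eq π hπ, udr_eq σ hσ, changes_congr true π.1 σ.1 h]
    intro i hi
    exact hlt ⟨i, by omega⟩ ⟨i + 1, hi⟩

/-- The permutation obtained by adding `N` to every letter. -/
def Permutation.shift (π : Permutation) (N : ℕ+) : Permutation :=
  ⟨π.1.map (· + N), π.2.map (add_left_injective N)⟩

theorem Permutation.length_shift (π : Permutation) (N : ℕ+) : (π.shift N).length = π.length := by
  simp [shift, length]

theorem udr_shift (π : Permutation) (N : ℕ+) : udr (π.shift N) = udr π := by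
  symm
  apply isStatistic_udr
  refine ⟨by simp [Permutation.shift], fun i j => ?_⟩
  simp only [Permutation.shift, List.get_eq_getElem, List.getElem_map,
    add_lt_add_iff_right]
  rfl

theorem le_of_mem_sum {l : List ℕ+} {a : ℕ+} (h : a ∈ l) :
    (a : ℕ) ≤ (l.map fun x : ℕ+ => (x : ℕ)).sum :=
  List.le_sum_of_mem (List.mem_map_of_mem h)

/-- A letter larger than all letters of `l`. -/
def largeLetter (l : List ℕ+) : ℕ+ := ((l.map fun x : ℕ+ => (x : ℕ)).sum).succPNat

theorem lt_largeLetter {l : List ℕ+} {a : ℕ+} (h : a ∈ l) : a < largeLetter l := by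
  rw [← PNat.coe_lt_coe, largeLetter, Nat.succPNat_coe]
  exact Nat.lt_succ_of_le (le_of_mem_sum h)

theorem disjoint_shift_largeLetter (π σ : Permutation) :
    π.Disjoint (σ.shift (largeLetter π.1)) := by
  intro a h h'
  obtain ⟨b, -, rfl⟩ := List.mem_map.1 h'
  have := lt_largeLetter h
  exact absurd (this.trans (PNat.lt_add_left _ _)) (lt_irrefl _)

theorem exists_changes_eq (n c : ℕ) (up : Bool) (h : c ≤ n) :
    ∃ (a : ℕ+) (l : List ℕ+), l.length = n ∧ (a :: l).Nodup ∧ changes up (a :: l) = c := by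
  induction n generalizing c up with
  | zero =>
    obtain rfl : c = 0 := by omega
    exact ⟨1, [], rfl, by simp, rfl⟩
  | succ n ih =>
    -- A descent is created by prepending a letter larger than all others, an ascent by raising
    -- every letter by one and prepending `1`.
    have key : ∀ (d : Bool) (b : ℕ+) (l : List ℕ+), (b :: l).Nodup →
        ∃ a b' l', l'.length = l.length ∧ (a :: b' :: l').Nodup ∧ decide (a < b') = d ∧
          changes d (b' :: l') = changes d (b :: l) := by
      intro d b l hl
      cases d
      · refine ⟨largeLetter (b :: l), b, l, rfl, List.nodup_cons.2 ⟨?_, hl⟩, ?_, rfl⟩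
        · exact fun h => lt_irrefl _ (lt_largeLetter h)
        · simpa using (lt_largeLetter (l := b :: l) (a := b) (by simp)).le
      · refine ⟨1, b + 1, l.map (· + 1), by simp,
          List.nodup_cons.2 ⟨?_, hl.map (add_left_injective 1)⟩, ?_, ?_⟩
        · intro h
          obtain ⟨x, -, hx⟩ := List.mem_map.1 (show (1 : ℕ+) ∈ (b :: l).map (· + 1) from h)
          have := PNat.lt_add_left 1 x
          rw [hx] at this
          exact lt_irrefl _ this
        · simp
        · refine (changes_congr true (b :: l) ((b :: l).map (· + 1)) (by simp) ?_).symm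
          intro i hi
          simp only [List.getElem_map, add_lt_add_iff_right]
    by_cases hc : c ≤ n
    · obtain ⟨b, l, h1, h2, h3⟩ := ih c up hc
      obtain ⟨a, b', l', k1, k2, k3, k4⟩ := key up b l h2
      refine ⟨a, b' :: l', by simp [k1, h1], k2, ?_⟩
      rw [changes, k3, if_pos rfl, k4, h3, zero_add]
    · obtain ⟨b, l, h1, h2, h3⟩ := ih n (!up) le_rfl
      obtain ⟨a, b', l', k1, k2, k3, k4⟩ := key (!up) b l h2
      refine ⟨a, b' :: l', by simp [k1, h1], k2, ?_⟩
      rw [changes, k3, if_neg (by cases up <;> simp), k4, h3]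
      omega

theorem exists_udr_eq {n j : ℕ} (hj : 1 ≤ j) (hjn : j ≤ n) :
    ∃ π : Permutation, π.length = n ∧ udr π = j := by
  obtain ⟨a, l, h1, h2, h3⟩ := exists_changes_eq (n - 1) (j - 1) true (by omega)
  refine ⟨⟨a :: l, h2⟩, ?_, ?_⟩
  · simp only [Permutation.length, List.length_cons]
    omega
  · rw [udr_eq _ (by simp), h3]
    omega

theorem udr_mem_Icc {π : Permutation} (h : 1 ≤ π.length) : 1 ≤ udr π ∧ udr π ≤ π.length := by
  obtain ⟨l, hl⟩ := π
  match l, hl, h with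
  | a :: l, hl, h =>
    rw [udr_eq _ (by simp)]
    have := changes_le true a l
    simp only [Permutation.length, List.length_cons]
    omega

/-! ### The image of a permutation -/

/-- The generating function of the numbers of labelings of `π`. -/
noncomputable def labelSeries (π : Permutation) : HadamardSeries :=
  fun k => ((labelings k π.1).card : ℚ)

/-- The image of `π` in the target algebra. -/
noncomputable def permGen (π : Permutation) : Polynomial HadamardSeries :=
  Polynomial.C (labelSeries π) * Polynomial.X ^ π.length

theorem labelSeries_eq {π : Permutation} (h : 1 ≤ π.length) :
    labelSeries π = toHadamard (udrSeries π.length (udr π)) := by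
  obtain ⟨l, hl⟩ := π
  match l, hl, h with
  | a :: l, hl, h =>
    rw [udr_eq _ (by simp)]
    funext k
    exact card_labelings_cons k a l hl

theorem labelSeries_of_length_eq_zero {π : Permutation} (h : π.length = 0) :
    labelSeries π = 1 := by
  have h' : π.1 = [] := List.length_eq_zero_iff.1 h
  funext k
  simp [labelSeries, h', labelings]

theorem permGen_eq_udrGen {π : Permutation} (h : 1 ≤ π.length) :
    permGen π = udrGen π.length (udr π) := by
  rw [permGen, labelSeries_eq h, udrGen]

/-- All coefficients of `1/(1 - t)` are `1`, so it is the unit of the Hadamard product. -/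
theorem udrGenZero_eq_one : udrGenZero = 1 := by
  have h : (1 - PowerSeries.X : PowerSeries ℚ)⁻¹ = PowerSeries.mk 1 := by
    rw [eq_comm, PowerSeries.eq_inv_iff_mul_eq_one (by simp)]
    exact PowerSeries.mk_one_mul_one_sub_eq_one ℚ
  have h' : toHadamard (PowerSeries.mk 1) = 1 := by
    funext k
    exact PowerSeries.coeff_mk k 1
  rw [udrGenZero, h, h', map_one]

theorem permGen_of_length_eq_zero {π : Permutation} (h : π.length = 0) : permGen π = 1 := by
  rw [permGen, labelSeries_of_length_eq_zero h, h, map_one, pow_zero, one_mul]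

theorem permGen_mul {π σ : Permutation} (hd : π.Disjoint σ) :
    permGen π * permGen σ = ∑ τ ∈ shuffles π σ, permGen τ := by
  have h : labelSeries π * labelSeries σ = ∑ τ ∈ shuffles π σ, labelSeries τ := by
    funext k
    rw [Finset.sum_apply]
    simp only [Pi.mul_apply, labelSeries]
    exact_mod_cast card_labelings_mul k hd
  calc permGen π * permGen σ = Polynomial.C (labelSeries π * labelSeries σ) *
        Polynomial.X ^ (π.length + σ.length) := by
        rw [permGen, permGen, map_mul]
        ring
    _ = _ := by
        rw [h, map_sum, Finset.sum_mul]
        refine Finset.sum_congr rfl fun τ hτ => ?_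
        rw [permGen, ((mem_shuffles hd).1 hτ).1]

theorem labelSeries_of_lt {π : Permutation} {k : ℕ} (h : k < udr π) : labelSeries π k = 0 := by
  rcases Nat.eq_zero_or_pos π.length with h0 | h0
  · rw [udr_nil π (List.length_eq_zero_iff.1 h0)] at h
    omega
  · rw [labelSeries_eq h0]
    change PowerSeries.coeff k (udrSeries π.length (udr π)) = 0
    rw [udrSeries, mul_comm (2 ^ _), mul_assoc, mul_assoc, PowerSeries.coeff_X_pow_mul',
      if_neg (by omega)]

/-- For nonempty `π` with `udr π = j` the lowest term of the series is `2^(j-1) t^j`; the empty word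
has the constant sequence `1`. -/
theorem labelSeries_udr_ne_zero (π : Permutation) : labelSeries π (udr π) ≠ 0 := by
  rcases Nat.eq_zero_or_pos π.length with h0 | h0
  · rw [labelSeries_of_length_eq_zero h0]
    exact one_ne_zero
  · rw [labelSeries_eq h0]
    change PowerSeries.coeff (udr π) (udrSeries π.length (udr π)) ≠ 0
    rw [udrSeries, mul_comm (2 ^ _), mul_assoc, mul_assoc, PowerSeries.coeff_X_pow_mul',
      if_pos le_rfl, Nat.sub_self, PowerSeries.coeff_zero_eq_constantCoeff_apply]
    have h2 : PowerSeries.constantCoeff (2 : PowerSeries ℚ) = 2 := map_ofNat _ 2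
    simp [PowerSeries.constantCoeff_inv, h2]

theorem permGen_congr {π σ : Permutation} (h : udr π = udr σ) (hl : π.length = σ.length) :
    permGen π = permGen σ := by
  rcases Nat.eq_zero_or_pos π.length with h0 | h0
  · rw [permGen_of_length_eq_zero h0, permGen_of_length_eq_zero (hl ▸ h0)]
  · rw [permGen_eq_udrGen h0, permGen_eq_udrGen (hl ▸ h0), h, hl]

/-! ### The linear map -/

/-- The image of a class in the target algebra. -/
noncomputable def classGen : StClass udr → Polynomial HadamardSeries :=
  Quotient.lift permGen fun _ _ h => permGen_congr h.1 h.2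

/-- The linear map from the shuffle algebra to the target algebra. -/
noncomputable def udrMap : ShuffleAlgebra udr →ₗ[ℚ] Polynomial HadamardSeries :=
  Finsupp.linearCombination ℚ classGen

theorem udrMap_cls (π : Permutation) : udrMap (cls udr π) = permGen π := by
  have : udrMap (cls udr π) = (1 : ℚ) • classGen (Quotient.mk (stSetoid udr) π) :=
    Finsupp.linearCombination_single ℚ 1 _
  rw [this, one_smul]
  rfl

theorem coeff_permGen (π : Permutation) (n k : ℕ) :
    (permGen π).coeff n k = if n = π.length then labelSeries π k else 0 := by
  rw [permGen, Polynomial.coeff_C_mul_X_pow]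
  split_ifs <;> rfl

theorem udrMap_injective : Function.Injective udrMap := by
  rw [← LinearMap.ker_eq_bot, LinearMap.ker_eq_bot']
  intro f hf
  by_contra hne
  let g : StClass udr →₀ ℚ := f
  have hg : g.support.Nonempty := Finsupp.support_nonempty_iff.2 hne
  have hsum : ∑ c ∈ g.support, g c • classGen c = 0 := hf
  let u : StClass udr → ℕ := Quotient.lift udr fun _ _ h => h.1
  obtain ⟨c₀, hc₀, hmin⟩ := Finset.exists_min_image g.support u hg
  -- At `x^|π| t^(udr π)`, with `udr π` minimal in the support, other lengths contribute nothing and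
  -- classes of the same length have larger order in `t`.
  obtain ⟨π, rfl⟩ := Quotient.exists_rep c₀
  have h := congrArg (fun p : Polynomial HadamardSeries => p.coeff π.length (udr π)) hsum
  simp only [Polynomial.finsetSum_coeff, Finset.sum_apply, Polynomial.coeff_smul,
    Pi.smul_apply, smul_eq_mul, Polynomial.coeff_zero, Pi.zero_apply] at h
  rw [Finset.sum_eq_single_of_mem _ hc₀] at h
  · have h' : (classGen (Quotient.mk _ π)).coeff π.length (udr π) = labelSeries π (udr π) := by
      change (permGen π).coeff π.length (udr π) = _
      rw [coeff_permGen, if_pos rfl]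
    rw [h'] at h
    exact (mul_ne_zero (Finsupp.mem_support_iff.1 hc₀) (labelSeries_udr_ne_zero π)) h
  · intro c hc hne
    obtain ⟨σ, rfl⟩ := Quotient.exists_rep c
    have h' : (classGen (Quotient.mk _ σ)).coeff π.length (udr π) = 0 := by
      change (permGen σ).coeff π.length (udr π) = _
      rw [coeff_permGen]
      split_ifs with hl
      · apply labelSeries_of_lt
        refine lt_of_le_of_ne (hmin _ hc) fun e => hne (Quotient.sound ⟨e.symm, hl.symm⟩)
      · rfl
    rw [h', mul_zero]

/-! ### Shuffle-compatibility and multiplicativity -/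

theorem shuffleCompatible_udr : ShuffleCompatible udr := by
  refine ⟨isStatistic_udr, fun π π' σ σ' hd hd' h1 h2 l1 l2 => ?_⟩
  -- Both formal sums have the same image, a product depending only on the values of `udr` and the
  -- lengths. Only linearity of `udrMap` is used, so there is no circularity with the product of
  -- classes.
  have hsum : ∑ τ ∈ shuffles π σ, cls udr τ = ∑ τ ∈ shuffles π' σ', cls udr τ := by
    apply udrMap_injective
    rw [map_sum, map_sum]
    simp only [udrMap_cls]
    rw [← permGen_mul hd, ← permGen_mul hd', permGen_congr h1 l1, permGen_congr h2 l2]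
  let u : StClass udr → ℕ := Quotient.lift udr fun _ _ h => h.1
  -- Keeping only the value of `udr` of each class turns the formal sums into multiplicity functions
  -- of the two multisets.
  let F : ShuffleAlgebra udr →ₗ[ℚ] (ℕ →₀ ℚ) := Finsupp.lmapDomain ℚ ℚ u
  have hF : ∀ τ, F (cls udr τ) = Finsupp.single (udr τ) 1 := fun τ => Finsupp.mapDomain_single
  have h := congrArg F hsum
  rw [map_sum, map_sum] at h
  simp only [hF] at h
  ext v
  have hv := congrArg (fun f => f v) h
  simp only [Finsupp.finsetSum_apply, Finsupp.single_apply, Finset.sum_boole] at hv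
  rw [Multiset.count_map, Multiset.count_map]
  simp only [eq_comm (a := v)]
  exact_mod_cast hv

theorem shuffleAlgebra_linearMap_ext {M : Type*} [AddCommGroup M] [Module ℚ M]
    {f g : ShuffleAlgebra udr →ₗ[ℚ] M} (h : ∀ π, f (cls udr π) = g (cls udr π)) : f = g := by
  refine Finsupp.lhom_ext' (M := ℚ) (N := M) fun c => LinearMap.ext_ring ?_
  obtain ⟨π, rfl⟩ := Quotient.exists_rep c
  exact h π

theorem udrMap_cls_mul_cls (π σ : Permutation) :
    udrMap (cls udr π * cls udr σ) = udrMap (cls udr π) * udrMap (cls udr σ) := by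
  -- Raising the letters of `σ` above those of `π` gives a disjoint representative of the same
  -- class.
  let σ' := σ.shift (largeLetter π.1)
  have hσ : cls udr σ = cls udr σ' := by
    have : Quotient.mk (stSetoid udr) σ = Quotient.mk (stSetoid udr) σ' :=
      Quotient.sound ⟨(udr_shift σ _).symm, (σ.length_shift _).symm⟩
    rw [cls, cls, this]
  have hd : π.Disjoint σ' := disjoint_shift_largeLetter π σ
  rw [hσ, cls_mul_cls shuffleCompatible_udr hd, map_sum]
  simp only [udrMap_cls]
  rw [permGen_mul hd]

theorem udrMap_mul (a b : ShuffleAlgebra udr) : udrMap (a * b) = udrMap a * udrMap b := by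
  have h : (mulMap udr).compr₂ udrMap = (LinearMap.mul ℚ _).compl₁₂ udrMap udrMap := by
    refine shuffleAlgebra_linearMap_ext fun π => shuffleAlgebra_linearMap_ext fun σ => ?_
    exact udrMap_cls_mul_cls π σ
  exact LinearMap.congr_fun₂ h a b

/-! ### The image and the isomorphism -/

theorem range_udrMap : LinearMap.range udrMap = udrSpan := by
  apply le_antisymm
  · rintro _ ⟨a, rfl⟩
    have h : (Submodule.mkQ udrSpan).comp udrMap = 0 := by
      refine shuffleAlgebra_linearMap_ext fun π => ?_
      rw [LinearMap.comp_apply, udrMap_cls, LinearMap.zero_apply, Submodule.mkQ_apply,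
        Submodule.Quotient.mk_eq_zero]
      apply Submodule.subset_span
      rcases Nat.eq_zero_or_pos π.length with h0 | h0
      · left
        rw [permGen_of_length_eq_zero h0, udrGenZero_eq_one]
        rfl
      · right
        obtain ⟨h1, h2⟩ := udr_mem_Icc h0
        exact ⟨π.length, udr π, h0, h1, h2, permGen_eq_udrGen h0⟩
    have h' := LinearMap.congr_fun h a
    rwa [LinearMap.comp_apply, LinearMap.zero_apply, Submodule.mkQ_apply,
      Submodule.Quotient.mk_eq_zero] at h'
  · refine Submodule.span_le.2 ?_
    rintro f (rfl | ⟨n, j, hn, hj, hjn, rfl⟩)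
    · refine ⟨cls udr ⟨[], List.nodup_nil⟩, ?_⟩
      rw [udrMap_cls, udrGenZero_eq_one, permGen_of_length_eq_zero rfl]
    · obtain ⟨π, rfl, rfl⟩ := exists_udr_eq hj hjn
      exact ⟨cls udr π, by rw [udrMap_cls, permGen_eq_udrGen hn]⟩

theorem one_mem_udrSpan : (1 : Polynomial HadamardSeries) ∈ udrSpan :=
  Submodule.subset_span (Or.inl udrGenZero_eq_one.symm)

theorem mul_mem_udrSpan (f g : Polynomial HadamardSeries) (hf : f ∈ udrSpan)
    (hg : g ∈ udrSpan) : f * g ∈ udrSpan := by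
  rw [← range_udrMap] at hf hg ⊢
  obtain ⟨a, rfl⟩ := hf
  obtain ⟨b, rfl⟩ := hg
  exact ⟨a * b, udrMap_mul a b⟩

/-- The span of the images of the classes, as a subalgebra. -/
noncomputable def udrSubalgebra : Subalgebra ℚ (Polynomial HadamardSeries) :=
  udrSpan.toSubalgebra one_mem_udrSpan mul_mem_udrSpan

/-- The linear isomorphism from the shuffle algebra onto `udrSubalgebra`. -/
noncomputable def udrEquiv : ShuffleAlgebra udr ≃ₗ[ℚ] udrSubalgebra :=
  (LinearEquiv.ofInjective udrMap udrMap_injective).trans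
    (LinearEquiv.ofEq (LinearMap.range udrMap) (Subalgebra.toSubmodule udrSubalgebra) (by
      rw [range_udrMap, udrSubalgebra, Submodule.toSubalgebra_toSubmodule]))

theorem coe_udrEquiv (a : ShuffleAlgebra udr) :
    (udrEquiv a : Polynomial HadamardSeries) = udrMap a := rfl

/-! ### Dimension of the homogeneous components -/

theorem linearIndependent_class :
    LinearIndependent ℚ fun c : StClass udr => (Finsupp.single c 1 : ShuffleAlgebra udr) :=
  Finsupp.linearIndependent_single_one ℚ (StClass udr)

theorem finrank_homogeneousComponent_udr {n : ℕ} (hn : 1 ≤ n) :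
    Module.finrank ℚ (homogeneousComponent udr n) = n := by
  -- One representative for each value `1, ..., n` of `udr`; these represent exactly the classes of
  -- length `n`.
  have hex : ∀ j : Fin n, ∃ π : Permutation, π.length = n ∧ udr π = j + 1 :=
    fun j => exists_udr_eq (by omega) (by omega)
  choose rep hlen hudr using hex
  have hspan : homogeneousComponent udr n =
      Submodule.span ℚ (Set.range fun j : Fin n => cls udr (rep j)) := by
    rw [homogeneousComponent]
    congr 1
    ext v
    constructor
    · rintro ⟨π, rfl, rfl⟩
      obtain ⟨h1, h2⟩ := udr_mem_Icc hn
      refine ⟨⟨udr π - 1, by omega⟩, ?_⟩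
      have : Quotient.mk (stSetoid udr) (rep ⟨udr π - 1, by omega⟩) =
          Quotient.mk (stSetoid udr) π :=
        Quotient.sound ⟨(hudr _).trans (Nat.sub_add_cancel h1), hlen _⟩
      change cls udr (rep _) = _
      rw [cls, cls, this]
    · rintro ⟨j, rfl⟩
      exact ⟨rep j, hlen j, rfl⟩
  have hli : LinearIndependent ℚ fun j : Fin n => cls udr (rep j) := by
    refine linearIndependent_class.comp (fun j => Quotient.mk (stSetoid udr) (rep j)) ?_
    intro i j hij
    have h : udr (rep i) = udr (rep j) := (Quotient.exact hij).1
    rw [hudr, hudr] at h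
    exact Fin.ext (by omega)
  rw [hspan, finrank_span_eq_card hli, Fintype.card_fin]

end ShuffleCompat

theorem theorem5p12 :
    ShuffleCompat.ShuffleCompatible ShuffleCompat.udr ∧
    (∃ B : Subalgebra ℚ (Polynomial ShuffleCompat.HadamardSeries),
      Subalgebra.toSubmodule B = ShuffleCompat.udrSpan ∧
      ∃ φ : ShuffleCompat.ShuffleAlgebra ShuffleCompat.udr ≃ₗ[ℚ] B,
        (∀ a b, φ (a * b) = φ a * φ b) ∧
        (∀ π : ShuffleCompat.Permutation, 1 ≤ π.length →
          (φ (ShuffleCompat.cls ShuffleCompat.udr π) : Polynomial ShuffleCompat.HadamardSeries) =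
            ShuffleCompat.udrGen π.length (ShuffleCompat.udr π)) ∧
        (∀ π : ShuffleCompat.Permutation, π.length = 0 →
          (φ (ShuffleCompat.cls ShuffleCompat.udr π) : Polynomial ShuffleCompat.HadamardSeries) =
            ShuffleCompat.udrGenZero)) ∧
    (∀ n : ℕ, 1 ≤ n →
      Module.finrank ℚ (ShuffleCompat.homogeneousComponent ShuffleCompat.udr n) = n) := by
  refine ⟨ShuffleCompat.shuffleCompatible_udr,
    ⟨ShuffleCompat.udrSubalgebra, Submodule.toSubalgebra_toSubmodule _ _ _,
      ShuffleCompat.udrEquiv, fun a b => Subtype.ext (ShuffleCompat.udrMap_mul a b),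
      fun π h => ?_, fun π h => ?_⟩, fun n hn => ShuffleCompat.finrank_homogeneousComponent_udr hn⟩
  · rw [ShuffleCompat.coe_udrEquiv, ShuffleCompat.udrMap_cls, ShuffleCompat.permGen_eq_udrGen h]
  · rw [ShuffleCompat.coe_udrEquiv, ShuffleCompat.udrMap_cls,
      ShuffleCompat.permGen_of_length_eq_zero h, ShuffleCompat.udrGenZero_eq_one]
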